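/- Fix a number $m \ge 1$ of bins. A *bin-stretching instance* is a finite (possibly empty) sequence $I = (x_1,\dots,x_k)$ of strictly positive real numbers for which there is a partition of $\{1,\dots,k\}$ into $m$ (possibly empty) parts $P_1,\dots,P_m$ with $\sum_{j\in P_i} x_j \le 1$ for every $i$; let $\mathcal I_{BS}$ be the set of all of them. An *online bin-stretching algorithm* $A$ assigns to each triple $(I,y,P)$, where $I=(x_1,\dots,x_k)$ is an instance, $y$ is a number such that $(x_1,\dots,x_k,y)$ is an instance, and $P=(P_1,\dots,P_m)$ is a partition of $\{1,\dots,k\}$ (the current arrangement of the items of $I$ in the bins), the index in $\{1,\dots,m\}$ of the bin that receives $y$. Starting from empty bins, $A$ packs the items of an instance $I=(x_1,\dots,x_k)$ one after the other in this way; let $R(I,A)$ be the total size of the items in the fullest bin after all the items of $I$ have been placed. The *stretching factor* of $A$ is $s_{BS}(A)=\sup_{I\in\mathcal I_{BS}} R(I,A)$, and the *optimal stretching factor* for $m$ bins is $s^*=\inf_A s_{BS}(A)$, the infimum over all online bin-stretching algorithms $A$. **Theorem.** Let $m\in\{6,7,8\}$. For every online bin-stretching algorithm $A$ for $m$ bins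 there is an instance $I\in\mathcal I_{BS}$ with $R(I,A)\ge \tfrac{15}{11}$. Hence every such algorithm satisfies $s_{BS}(A)\ge\tfrac{15}{11}$, and $s^*\ge \tfrac{15}{11}$. -/

import Mathlib

namespace BinStretching

/-- `P` is an indexed partition `(P 0, …, P (m-1))` of the index set `{0, …, k-1}` into `m` pairwise
disjoint, possibly empty, parts. The positions of the items of a sequence are numbered from `0`. -/
def IsPartition (m k : ℕ) (P : Fin m → Finset ℕ) : Prop :=
  (∀ i i' : Fin m, i ≠ i' → Disjoint (P i) (P i')) ∧ Finset.univ.biUnion P = Finset.range k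

/-- The total size of the items of `I` at the positions in `S`
(in all uses `S` contains only valid positions of `I`, so the default value is never read). -/
noncomputable def load (I : List ℝ) (S : Finset ℕ) : ℝ :=
  ∑ j ∈ S, I.getD j 0

/-- A bin-stretching instance for `m` bins: a finite sequence of strictly positive reals that can be
partitioned into `m` parts of total size at most `1` each. -/
def IsInstance (m : ℕ) (I : List ℝ) : Prop :=
  (∀ x ∈ I, 0 < x) ∧
    ∃ P : Fin m → Finset ℕ, IsPartition m I.length P ∧ ∀ i, load I (P i) ≤ 1

/-- A (deterministic) online algorithm for `m` bins: from the sequence `I` of the items received so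
far, the next item `y`, and the current arrangement `P` of the items of `I` in the bins, it computes
the bin that receives `y`. Only its values at triples `(I, y, P)` in which `I` followed by `y` is an
instance and `P` is a partition of the positions of `I` are ever used below; its values at other
triples are arbitrary. -/
abbrev Algorithm (m : ℕ) : Type :=
  List ℝ → ℝ → (Fin m → Finset ℕ) → Fin m

/-- `packing A I j` is the arrangement in the bins of the first `j` items of `I`, as placed one after
the other by `A`. -/
noncomputable def packing {m : ℕ} (A : Algorithm m) (I : List ℝ) : ℕ → Fin m → Finset ℕ
  | 0 => fun _ => ∅
  | j + 1 => fun i =>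
      if A (I.take j) (I.getD j 0) (packing A I j) = i then insert j (packing A I j i)
      else packing A I j i

/-- The result `R(I, A)`: the load of the fullest bin after `A` has placed all the items of `I`. -/
noncomputable def result {m : ℕ} (I : List ℝ) (A : Algorithm m) : ℝ :=
  ⨆ i : Fin m, load I (packing A I I.length i)

/-- The stretching factor of `A`: the supremum over all instances `I` of `R(I, A)`. -/
noncomputable def stretchingFactor {m : ℕ} (A : Algorithm m) : ℝ :=
  sSup {r : ℝ | ∃ I : List ℝ, IsInstance m I ∧ r = result I A}

/-- The optimal stretching factor `s*` for `m` bins: the infimum of the stretching factors of all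
online algorithms. -/
noncomputable def optimalStretchingFactor (m : ℕ) : ℝ :=
  ⨅ A : Algorithm m, stretchingFactor A

theorem isPartition_packing {m : ℕ} (A : Algorithm m) (I : List ℝ) (k : ℕ) :
    IsPartition m k (packing A I k) := by
  induction k with
  | zero => exact ⟨fun _ _ _ => by simp [packing], by ext; simp [packing]⟩
  | succ k ih =>
    obtain ⟨hd, hu⟩ := ih
    have hmem : ∀ i x, x ∈ packing A I k i → x < k := fun i x hx => by
      have : x ∈ Finset.univ.biUnion (packing A I k) := by
        simp only [Finset.mem_biUnion, Finset.mem_univ, true_and]; exact ⟨i, hx⟩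
      rw [hu] at this
      simpa using this
    refine ⟨fun i i' hne => ?_, ?_⟩
    · have h0 := hd i i' hne
      rw [Finset.disjoint_left] at h0 ⊢
      intro x hx hx'
      simp only [packing] at hx hx'
      split_ifs at hx hx' with h1 h2 h2
      · exact hne (h1.symm.trans h2)
      · rcases Finset.mem_insert.1 hx with rfl | hx
        · exact absurd (hmem _ _ hx') (lt_irrefl _)
        · exact h0 hx hx'
      · rcases Finset.mem_insert.1 hx' with rfl | hx'
        · exact absurd (hmem _ _ hx) (lt_irrefl _)
        · exact h0 hx hx'
      · exact h0 hx hx'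
    · ext x
      have hx : (∃ i, x ∈ packing A I k i) ↔ x < k := by
        have := congrArg (x ∈ ·) hu
        simpa using this
      simp only [Finset.mem_biUnion, Finset.mem_univ, true_and, Finset.mem_range]
      constructor
      · rintro ⟨i, hi⟩
        simp only [packing] at hi
        split_ifs at hi
        · rcases Finset.mem_insert.1 hi with rfl | hi
          · omega
          · have := hmem _ _ hi; omega
        · have := hmem _ _ hi; omega
      · intro hlt
        rcases Nat.lt_succ_iff_lt_or_eq.1 hlt with h | rfl
        · obtain ⟨i, hi⟩ := hx.2 h
          refine ⟨i, ?_⟩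
          simp only [packing]
          split_ifs
          · exact Finset.mem_insert_of_mem hi
          · exact hi
        · exact ⟨A (I.take x) (I.getD x 0) (packing A I x), by simp [packing]⟩

theorem load_nonneg {m : ℕ} {I : List ℝ} (hI : IsInstance m I) (S : Finset ℕ) : 0 ≤ load I S := by
  refine Finset.sum_nonneg fun j _ => ?_
  by_cases hj : j < I.length
  · rw [List.getD_eq_getElem _ _ hj]
    exact (hI.1 _ (List.getElem_mem hj)).le
  · rw [List.getD_eq_default _ _ (not_lt.1 hj)]

theorem load_le {m : ℕ} {I : List ℝ} (hI : IsInstance m I) {S : Finset ℕ}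
    (hS : S ⊆ Finset.range I.length) : load I S ≤ m := by
  obtain ⟨P, ⟨hd, hu⟩, hl⟩ := hI.2
  have hn : ∀ j, 0 ≤ I.getD j 0 := fun j => by
    simpa [load] using load_nonneg hI {j}
  calc load I S ≤ load I (Finset.range I.length) :=
        Finset.sum_le_sum_of_subset_of_nonneg hS fun j _ _ => hn j
    _ = ∑ i, load I (P i) := by
        rw [← hu]; exact Finset.sum_biUnion fun i _ i' _ h => hd i i' h
    _ ≤ ∑ _i : Fin m, (1 : ℝ) := Finset.sum_le_sum fun i _ => hl i
    _ = m := by simp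

/-- The supremum that defines the stretching factor is that of a set bounded above. -/
theorem bddAbove_results {m : ℕ} (A : Algorithm m) :
    BddAbove {r : ℝ | ∃ I : List ℝ, IsInstance m I ∧ r = result I A} := by
  refine ⟨m, ?_⟩
  rintro _ ⟨I, hI, rfl⟩
  refine Real.iSup_le (fun i => load_le hI ?_) (Nat.cast_nonneg m)
  rw [← (isPartition_packing A I I.length).2]
  exact Finset.subset_biUnion_of_mem _ (Finset.mem_univ i)

/-- The infimum that defines the optimal stretching factor is that of a set bounded below. -/
theorem bddBelow_stretchingFactors (m : ℕ) :
    BddBelow (Set.range fun A : Algorithm m => stretchingFactor A) := by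
  refine ⟨0, ?_⟩
  rintro _ ⟨A, rfl⟩
  refine Real.sSup_nonneg ?_
  rintro _ ⟨I, hI, rfl⟩
  exact Real.iSup_nonneg fun i => load_nonneg hI _

end BinStretching

/-! Measure sizes in elevenths and let the sender use integer sizes only. The claim becomes a finite
game: the sender wins if some bin reaches load 15 while all items sent fit offline into `m` bins of
capacity 11. Bins are interchangeable and the past matters only through its outcome, so a position
is a pair of multisets, the loads and the items; `Wins` says that the sender wins from it.

A winning strategy branches over the bin chosen at each step, until enough equal items can be sent
that not all fit below load 15. This last stage is settled by pigeonhole (`wins_of_repeat`) and one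
offline packing (`packable_of_fits`). That packing also serves all earlier positions on the way,
since packability passes to submultisets.

The strategies are found beforehand and stored as numbers. `check` replays one of them layer by
layer, merging positions reached in several ways. By `wins_of_check` its success implies `Wins` from
the empty bins, and `exists_of_wins` plays the strategy against an arbitrary algorithm. -/

namespace BinStretching

/-! ### The evaluator, written for fast reduction by the kernel -/

/-- `force n k` is `k n`; when it is evaluated, `n` is evaluated before it is passed to `k`. -/
def force {α : Type} (n : ℕ) (k : ℕ → α) : α :=
  -- Reduction is lazy; the case distinction makes it compute `n` once, before `k` can copy it
  -- unevaluated.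
  Nat.rec (k 0) (fun p _ => k (Nat.succ p)) n

/-- `forceList l c k` evaluates the entries of `l` and passes to `k` the list and the number whose
hexadecimal digits are those of `c` followed by the entries of `l`. -/
def forceList : List ℕ → ℕ → (List ℕ → ℕ → Bool) → Bool
  | [], c, k => k [] c
  | x :: l, c, k =>
    force x fun x => force (Nat.add (Nat.mul c 16) x) fun c =>
      forceList l c fun l' c' => k (x :: l') c'

/-- Equality of lists of natural numbers. -/
def listEq : List ℕ → List ℕ → Bool
  | [], [] => true
  | x :: l, y :: l' => bif Nat.beq x y then listEq l l' else false
  | _, _ => false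

/-- Insertion into an ascending list. -/
def insertAsc (y : ℕ) : List ℕ → List ℕ
  | [] => [y]
  | x :: l => bif Nat.ble y x then y :: x :: l else x :: insertAsc y l

/-- Insertion of the entries of `ys`, all equal to `y`, into a descending list. -/
def insertDesc (y : ℕ) (ys : List ℕ) : List ℕ → List ℕ
  | [] => ys
  | x :: l => bif Nat.ble x y then ys.append (x :: l) else x :: insertDesc y ys l

/-- The items that remain when a bin of capacity `c` is filled by the first-fit rule, except that
the binary digits `1` of `w` mark items to be passed over although they fit. -/
def fill : ℕ → ℕ → List ℕ → List ℕ
  | _, _, [] => []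
  | c, w, x :: l =>
    bif Nat.ble x c then
      bif Nat.beq (Nat.mod w 2) 0 then fill (Nat.sub c x) (Nat.div w 2) l
      else x :: fill c (Nat.div w 2) l
    else x :: fill c w l

/-- Whether the items are packed into `m` bins of capacity `11` when each is filled by `fill`, the
`i`-th one with the `i`-th digit of `s` in base `1024`. -/
def fits : ℕ → ℕ → List ℕ → Bool
  | _, _, [] => true
  | 0, _, _ :: _ => false
  | m + 1, s, x :: l => fits m (Nat.div s 1024) (fill 11 (Nat.mod s 1024) (x :: l))

/-- The number of items of size `y` that bins with the given loads can take. -/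
def room (y : ℕ) : List ℕ → ℕ
  | [] => 0
  | x :: l => Nat.add (Nat.div (Nat.sub 14 x) y) (room y l)

/-- Binary search trees whose nodes carry a key, the loads of the bins and the items. -/
inductive StateTree : Type
  | empty : StateTree
  | node : StateTree → ℕ → List ℕ → List ℕ → StateTree → StateTree

namespace StateTree

/-- Passes to `k` the tree with the state `(L, a)` inserted at the key `h`. -/
def insert (h : ℕ) (L a : List ℕ) : StateTree → (StateTree → Bool) → Bool
  | empty, k => k (node empty h L a empty)
  | node l h' L' a' r, k =>
    bif Nat.beq h h' then
      bif listEq L L' then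
        bif listEq a a' then k (node l h' L' a' r)
        else insert h L a l fun l' => k (node l' h' L' a' r)
      else insert h L a l fun l' => k (node l' h' L' a' r)
    else bif Nat.ble h h' then insert h L a l fun l' => k (node l' h' L' a' r)
    else insert h L a r fun r' => k (node l h' L' a' r')

/-- The states in the tree, followed by those in `acc`. -/
def toList : StateTree → List (List ℕ × List ℕ) → List (List ℕ × List ℕ)
  | empty, acc => acc
  | node l _ L a r, acc => l.toList ((L, a) :: r.toList acc)

end StateTree

/-- Whether `x` is the first entry of the list. -/
def headEq (x : ℕ) : List ℕ → Bool
  | [] => false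
  | y :: _ => Nat.beq x y

/-- Inserts into the tree the states that arise when an item of size `y` is put into one of the bins
with loads `post` that do not reach the load `15`, the loads of the other bins being those in `pre`.
The items are then `a`, and `c` is a number computed from `a` that enters the keys. -/
def branch (y : ℕ) (a : List ℕ) (c : ℕ) :
    List ℕ → List ℕ → StateTree → (StateTree → Bool) → Bool
  | _, [], t, k => k t
  | pre, x :: post, t, k =>
    bif headEq x post then branch y a c (x :: pre) post t k
    else bif Nat.ble 15 (Nat.add x y) then branch y a c (x :: pre) post t k
    else forceList (List.reverseAux pre (insertAsc (Nat.add x y) post)) 0 fun L h =>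
      -- Scrambling the keys is meant to keep the unbalanced search tree shallow; soundness does not
      -- depend on it.
      force (Nat.mod (Nat.mul (Nat.add h c) 0x9E3779B97F4A7C15) 0x1fffffffffffffff) fun h =>
        StateTree.insert h L a t fun t' => branch y a c (x :: pre) post t' k

/-- Whether the first bin can take an item of size `y` without reaching the load `15`. -/
def canTake (y : ℕ) : List ℕ → Bool
  | [] => false
  | x :: _ => Nat.ble (Nat.add x y) 14

/-- Whether the items can still be packed when so many items of size `y` are added that some bin
must reach the load `15`. -/
def overfull (m y s : ℕ) (L a : List ℕ) : Bool :=
  fits m s (insertDesc y (List.replicate (Nat.succ (room y L)) y) a)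

/-- Evaluation of a strategy of the sender of the items. The states in the list are those with the
current number of items that are still to be treated; the tree collects the states with one item
more; the digits of `s` in base `32` tell what to send in the successive states. A digit `d` with
`1 ≤ d ≤ 16` means a single item of size `d`. A digit `16 + y` means items of size `y` until some bin
reaches the load `15`, and `0` followed by `y` means the same, the packing of the items into `m` bins
of capacity `11` being given by the next `m` digits in base `1024`. -/
def check (m : ℕ) : ℕ → List (List ℕ × List ℕ) → StateTree → ℕ → Bool
  | 0, _, _, _ => false
  | _ + 1, [], .empty, _ => true
  | n + 1, [], .node l h L a r, s => check m n ((StateTree.node l h L a r).toList []) .empty s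
  | n + 1, (L, a) :: q, t, s =>
    force (Nat.mod s 32) fun d => force (Nat.div s 32) fun s =>
      bif Nat.beq d 0 then
        force (Nat.mod s 32) fun y => force (Nat.div s 32) fun s =>
          bif Nat.ble 1 y then
            bif overfull m y s L a then check m n q t (Nat.div s (Nat.pow 1024 m)) else false
          else false
      else bif Nat.ble d 16 then
        bif canTake d L then
          forceList (insertDesc d [d] a) 0 fun a' c =>
            -- The factor is `16 ^ 8`: it shifts the code of the items past the hexadecimal digits
            -- of up to eight loads, each at most 14.
            branch d a' (Nat.mul c 0x100000000) [] L t fun t' => check m n q t' s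
        else false
      else bif overfull m (Nat.sub d 16) 0 L a then check m n q t s else false

/-! ### Offline packings and the game -/

/-- Whether items of integer sizes can be packed into `m` bins of capacity `11`. -/
def Packable (m : ℕ) (a : Multiset ℕ) : Prop :=
  ∃ f : Fin m → Multiset ℕ, ∑ i, f i = a ∧ ∀ i, (f i).sum ≤ 11

theorem Packable.of_cons {m y : ℕ} {a : Multiset ℕ} (h : Packable m (y ::ₘ a)) :
    Packable m a := by
  obtain ⟨f, hf, hc⟩ := h
  obtain ⟨i, -, hi⟩ : ∃ i ∈ Finset.univ, y ∈ f i := by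
    rw [← Multiset.mem_sum, hf]
    exact Multiset.mem_cons_self y a
  obtain ⟨b, hb⟩ := Multiset.exists_cons_of_mem hi
  refine ⟨Function.update f i b, ?_, fun j => ?_⟩
  · rw [← Finset.add_sum_erase _ _ (Finset.mem_univ i), hb, Multiset.cons_add,
      Multiset.cons_inj_right] at hf
    rw [← Finset.add_sum_erase _ _ (Finset.mem_univ i), Function.update_self, ← hf]
    congr 1
    exact Finset.sum_congr rfl fun j hj => Function.update_of_ne (Finset.ne_of_mem_erase hj) _ _
  · by_cases hj : j = i
    · subst hj
      have := hc j
      rw [hb, Multiset.sum_cons] at this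
      rw [Function.update_self]
      omega
    · rw [Function.update_of_ne hj]
      exact hc j

theorem Packable.of_add {m : ℕ} {a b : Multiset ℕ} (h : Packable m (b + a)) : Packable m a := by
  induction b using Multiset.induction with
  | empty => simpa using h
  | cons y b ih => exact ih (by rw [Multiset.cons_add] at h; exact h.of_cons)

theorem Packable.add_bin {m : ℕ} {a b : Multiset ℕ} (h : Packable m a) (hb : b.sum ≤ 11) :
    Packable (m + 1) (b + a) := by
  obtain ⟨f, hf, hc⟩ := h
  refine ⟨Fin.cons b f, by simp [Fin.sum_univ_succ, hf], fun i => ?_⟩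
  refine Fin.cases ?_ (fun j => ?_) i
  · simpa using hb
  · simpa using hc j

theorem packable_zero (m : ℕ) : Packable m 0 := ⟨fun _ => 0, by simp, by simp⟩

/-- Whatever the mask `w` is, an item is either passed over or taken while it fits, so masks need no
verification. -/
theorem exists_fill (l : List ℕ) :
    ∀ c w, ∃ b : Multiset ℕ, b.sum ≤ c ∧ (l : Multiset ℕ) = b + (fill c w l : Multiset ℕ) := by
  induction l with
  | nil => exact fun c w => ⟨0, by simp, by simp [fill]⟩
  | cons x l ih =>
    intro c w
    cases h : Nat.ble x c with
    | false =>
      obtain ⟨b, hb, e⟩ := ih c w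
      refine ⟨b, hb, ?_⟩
      simp only [fill, h, cond_false]
      rw [← Multiset.cons_coe, ← Multiset.cons_coe, e, Multiset.add_cons]
    | true =>
      cases hw : Nat.beq (Nat.mod w 2) 0 with
      | false =>
        obtain ⟨b, hb, e⟩ := ih c (Nat.div w 2)
        refine ⟨b, hb, ?_⟩
        simp only [fill, h, hw, cond_true, cond_false]
        rw [← Multiset.cons_coe, ← Multiset.cons_coe, e, Multiset.add_cons]
      | true =>
        obtain ⟨b, hb, e⟩ := ih (Nat.sub c x) (Nat.div w 2)
        refine ⟨x ::ₘ b, ?_, ?_⟩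
        · have := Nat.le_of_ble_eq_true h
          rw [Nat.sub_eq] at hb
          rw [Multiset.sum_cons]
          omega
        · simp only [fill, h, hw, cond_true]
          rw [← Multiset.cons_coe, e, Multiset.cons_add]

theorem packable_of_fits (m : ℕ) : ∀ (s : ℕ) (l : List ℕ), fits m s l = true → Packable m l := by
  induction m with
  | zero =>
    rintro s (_ | ⟨x, l⟩) h
    · exact packable_zero 0
    · simp [fits] at h
  | succ m ih =>
    rintro s (_ | ⟨x, l⟩) h
    · exact packable_zero _
    · obtain ⟨b, hb, e⟩ := exists_fill (x :: l) 11 (s % 1024)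
      rw [e]
      exact (ih _ _ h).add_bin hb

/-- `Wins m L a`: when the loads of the bins are `L` and the items received so far are `a`, further
items can be sent such that some bin reaches the load `15` while all items sent can be packed into
`m` bins of capacity `11`. -/
inductive Wins (m : ℕ) : Multiset ℕ → Multiset ℕ → Prop
  | full {L a : Multiset ℕ} {x : ℕ} : x ∈ L → 15 ≤ x → Packable m a → Wins m L a
  | send {L a : Multiset ℕ} (y : ℕ) : 0 < y →
      (∀ x ∈ L, Wins m ((x + y) ::ₘ L.erase x) (y ::ₘ a)) → Wins m L a

/-- Follow any branch to its end and drop the items sent since. Without bins there is no branch to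
follow, hence the condition on `L`. -/
theorem Wins.packable {m : ℕ} {L a : Multiset ℕ} (h : Wins m L a) (hL : L ≠ 0) :
    Packable m a := by
  induction h with
  | full _ _ h => exact h
  | send y _ _ ih =>
    obtain ⟨x, hx⟩ := Multiset.exists_mem_of_ne_zero hL
    exact (ih x hx (Multiset.cons_ne_zero)).of_cons

/-- Pigeonhole: a bin of load `x` takes at most `(14 - x) / y` items of size `y` without reaching
15. Each item so taken lowers the total room by one, so `N` items cannot all be absorbed. -/
theorem wins_of_repeat {m y : ℕ} (hy : 0 < y) (N : ℕ) :
    ∀ L a : Multiset ℕ, (L.map fun x => (14 - x) / y).sum < N →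
      Packable m (Multiset.replicate N y + a) → Wins m L a := by
  induction N with
  | zero => intro L a h; omega
  | succ N ih =>
    intro L a h hp
    have e : Multiset.replicate (N + 1) y + a = Multiset.replicate N y + (y ::ₘ a) := by
      rw [Multiset.replicate_succ, Multiset.cons_add, Multiset.add_cons]
    rw [e] at hp
    refine .send y hy fun x hx => ?_
    by_cases hxy : 15 ≤ x + y
    · exact .full (Multiset.mem_cons_self _ _) hxy hp.of_add
    · refine ih _ _ ?_ hp
      rw [← Multiset.cons_erase hx, Multiset.map_cons, Multiset.sum_cons] at h
      rw [Multiset.map_cons, Multiset.sum_cons]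
      -- Here `x + y ≤ 14`, so no subtraction is truncated.
      have h1 : (14 - x) / y = (14 - (x + y)) / y + 1 := by
        rw [← Nat.add_div_right _ hy]
        congr 1
        omega
      omega

/-! ### Soundness of the evaluator -/

theorem force_eq {α : Type} (n : ℕ) (k : ℕ → α) : force n k = k n := by
  cases n <;> rfl

/-- The code `c'` is used only in keys, so its value can stay unspecified. -/
theorem forceList_eq (l : List ℕ) :
    ∀ c, ∃ c', ∀ k, forceList l c k = k l c' := by
  induction l with
  | nil => exact fun c => ⟨c, fun k => rfl⟩
  | cons x l ih =>
    intro c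
    obtain ⟨c', h⟩ := ih (Nat.add (Nat.mul c 16) x)
    exact ⟨c', fun k => by simp only [forceList, force_eq, h]⟩

theorem eq_of_listEq (l : List ℕ) : ∀ l', listEq l l' = true → l = l' := by
  induction l with
  | nil => rintro (_ | ⟨y, l'⟩) h <;> simp_all [listEq]
  | cons x l ih =>
    rintro (_ | ⟨y, l'⟩) h
    · simp [listEq] at h
    · simp only [listEq, Bool.cond_false_right, Bool.and_eq_true, Nat.beq_eq] at h
      rw [h.1, ih _ h.2]

theorem coe_insertAsc (y : ℕ) (l : List ℕ) :
    (insertAsc y l : Multiset ℕ) = y ::ₘ (l : Multiset ℕ) := by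
  induction l with
  | nil => rfl
  | cons x l ih =>
    cases h : Nat.ble y x with
    | true => simp only [insertAsc, h, cond_true, Multiset.cons_coe]
    | false =>
      simp only [insertAsc, h, cond_false]
      rw [← Multiset.cons_coe, ih, ← Multiset.cons_coe, Multiset.cons_swap]

theorem coe_insertDesc (y : ℕ) (ys l : List ℕ) :
    (insertDesc y ys l : Multiset ℕ) = (ys : Multiset ℕ) + (l : Multiset ℕ) := by
  induction l with
  | nil => simp [insertDesc]
  | cons x l ih =>
    cases h : Nat.ble x y with
    | true =>
      simp only [insertDesc, h, cond_true]
      exact (Multiset.coe_add _ _).symm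
    | false =>
      simp only [insertDesc, h, cond_false]
      rw [← Multiset.cons_coe, ih, ← Multiset.cons_coe, Multiset.add_cons]

theorem room_eq (y : ℕ) (l : List ℕ) :
    room y l = ((l : Multiset ℕ).map fun x => (14 - x) / y).sum := by
  induction l with
  | nil => rfl
  | cons x l ih =>
    rw [← Multiset.cons_coe, Multiset.map_cons, Multiset.sum_cons, ← ih]
    rfl

theorem wins_of_overfull {m y s : ℕ} {L a : List ℕ} (hy : 0 < y)
    (h : overfull m y s L a = true) : Wins m L a := by
  refine wins_of_repeat hy (room y L + 1) _ _ (by rw [room_eq]; omega) ?_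
  have := packable_of_fits _ _ _ h
  rwa [coe_insertDesc, Multiset.coe_replicate] at this

namespace StateTree

/-- The states at the nodes of the tree all satisfy `p`. -/
def Forall (p : List ℕ → List ℕ → Prop) : StateTree → Prop
  | empty => True
  | node l _ L a r => l.Forall p ∧ p L a ∧ r.Forall p

/-- No ordering invariant of the tree is needed: a state is dropped only after both of its lists
were compared with a stored one, so bad keys could cost time but lose nothing. -/
theorem exists_insert (h : ℕ) (L a : List ℕ) (t : StateTree) :
    ∃ t', (∀ k, insert h L a t k = k t') ∧
      ∀ p, t'.Forall p → t.Forall p ∧ p L a := by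
  induction t with
  | empty => exact ⟨node empty h L a empty, fun k => rfl, fun p hp => ⟨trivial, hp.2.1⟩⟩
  | node l h' L' a' r ihl ihr =>
    obtain ⟨l', hl, hl'⟩ := ihl
    obtain ⟨r', hr, hr'⟩ := ihr
    have left : ∀ p, (node l' h' L' a' r).Forall p → (node l h' L' a' r).Forall p ∧ p L a :=
      fun p hp => ⟨⟨(hl' p hp.1).1, hp.2⟩, (hl' p hp.1).2⟩
    by_cases e : Nat.beq h h' = true
    · by_cases eL : listEq L L' = true
      · by_cases ea : listEq a a' = true
        · refine ⟨node l h' L' a' r, fun k => by simp only [insert, e, eL, ea, cond_true], ?_⟩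
          rw [eq_of_listEq _ _ eL, eq_of_listEq _ _ ea]
          exact fun p hp => ⟨hp, hp.2.1⟩
        · exact ⟨_, fun k => by simp only [insert, e, eL, ea, cond_true, cond_false, hl], left⟩
      · exact ⟨_, fun k => by simp only [insert, e, eL, cond_true, cond_false, hl], left⟩
    · by_cases e' : Nat.ble h h' = true
      · exact ⟨_, fun k => by simp only [insert, e, e', cond_true, cond_false, hl], left⟩
      · refine ⟨node l h' L' a' r', fun k => by simp only [insert, e, e', cond_false, hr], ?_⟩
        exact fun p hp => ⟨⟨hp.1, hp.2.1, (hr' p hp.2.2).1⟩, (hr' p hp.2.2).2⟩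

theorem forall_of_toList {p : List ℕ → List ℕ → Prop} (t : StateTree) :
    ∀ acc, (∀ s ∈ t.toList acc, p s.1 s.2) → t.Forall p ∧ ∀ s ∈ acc, p s.1 s.2 := by
  induction t with
  | empty => exact fun acc h => ⟨trivial, h⟩
  | node l h' L a r ihl ihr =>
    intro acc h
    obtain ⟨h1, h2⟩ := ihl _ h
    obtain ⟨h3, h4⟩ := ihr acc fun s hs => h2 s (List.mem_cons_of_mem _ hs)
    exact ⟨⟨h1, h2 (L, a) List.mem_cons_self, h3⟩, h4⟩

end StateTree

theorem eq_of_headEq {x : ℕ} {l : List ℕ} (h : headEq x l = true) : x ∈ l := by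
  cases l with
  | nil => simp [headEq] at h
  | cons y l => rw [Nat.eq_of_beq_eq_true h]; exact List.mem_cons_self

/-- Bins of equal load lead to the same multiset of loads, so within a run of equal entries only the
last is treated. The sum of `pre` and `post` is the invariant of the recursion. -/
theorem exists_branch (y : ℕ) (a : List ℕ) (c : ℕ) (post : List ℕ) :
    ∀ pre t, ∃ t', (∀ k, branch y a c pre post t k = k t') ∧
      ∀ p : Multiset ℕ → Multiset ℕ → Prop, t'.Forall (fun L a => p L a) →
        t.Forall (fun L a => p L a) ∧
        ∀ x ∈ post, x + y < 15 →
          p ((x + y) ::ₘ ((pre : Multiset ℕ) + (post : Multiset ℕ)).erase x) a := by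
  induction post with
  | nil => exact fun pre t => ⟨t, fun k => rfl, fun p hp => ⟨hp, by simp⟩⟩
  | cons x post ih =>
    intro pre t
    have e : ((x :: pre : List ℕ) : Multiset ℕ) + (post : Multiset ℕ) =
        (pre : Multiset ℕ) + ((x :: post : List ℕ) : Multiset ℕ) := by
      rw [← Multiset.cons_coe, ← Multiset.cons_coe, Multiset.add_cons, Multiset.cons_add]
    cases h1 : headEq x post with
    | true =>
      obtain ⟨t', ht, ht'⟩ := ih (x :: pre) t
      refine ⟨t', fun k => by simp only [branch, h1, cond_true, ht], fun p hp => ?_⟩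
      obtain ⟨h2, h3⟩ := ht' p hp
      refine ⟨h2, fun z hz => ?_⟩
      rw [e] at h3
      rcases List.mem_cons.1 hz with rfl | hz
      · exact h3 _ (eq_of_headEq h1)
      · exact h3 z hz
    | false =>
      cases h2 : Nat.ble 15 (Nat.add x y) with
      | true =>
        obtain ⟨t', ht, ht'⟩ := ih (x :: pre) t
        refine ⟨t', fun k => by simp only [branch, h1, h2, cond_true, cond_false, ht],
          fun p hp => ?_⟩
        obtain ⟨h3, h4⟩ := ht' p hp
        refine ⟨h3, fun z hz hzy => ?_⟩
        rw [e] at h4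
        rcases List.mem_cons.1 hz with rfl | hz
        · exact absurd hzy (not_lt.2 (Nat.le_of_ble_eq_true h2))
        · exact h4 z hz hzy
      | false =>
        obtain ⟨h, hL⟩ := forceList_eq (List.reverseAux pre (insertAsc (Nat.add x y) post)) 0
        obtain ⟨t1, ht1, ht1'⟩ := StateTree.exists_insert
          (Nat.mod (Nat.mul (Nat.add h c) 0x9E3779B97F4A7C15) 0x1fffffffffffffff)
          (List.reverseAux pre (insertAsc (Nat.add x y) post)) a t
        obtain ⟨t', ht, ht'⟩ := ih (x :: pre) t1
        refine ⟨t', fun k => by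
          simp only [branch, h1, h2, cond_false, hL, force_eq, ht1, ht], fun p hp => ?_⟩
        obtain ⟨h3, h4⟩ := ht' p hp
        obtain ⟨h5, h6⟩ := ht1' _ h3
        refine ⟨h5, fun z hz hzy => ?_⟩
        rw [e] at h4
        rcases List.mem_cons.1 hz with rfl | hz
        · rw [List.reverseAux_eq, ← Multiset.coe_add, Multiset.coe_reverse, coe_insertAsc,
            Multiset.add_cons] at h6
          rwa [← e, ← Multiset.cons_coe, Multiset.cons_add, Multiset.erase_cons_head]
        · exact h4 z hz hzy

/-- The induction on the fuel argues backwards: success of the remaining run makes all collected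
successors winning, hence also the state that produced them. The tree must be part of the claim
because successors wait there until the next layer. -/
theorem wins_of_check (m n : ℕ) :
    ∀ q t s, check m n q t s = true →
      (∀ u ∈ q, Wins m u.1 u.2) ∧ t.Forall fun L a => Wins m L a := by
  induction n with
  | zero => intro q t s h; simp [check] at h
  | succ n ih =>
    rintro (_ | ⟨⟨L, a⟩, q⟩) t s h
    · cases t with
      | empty => exact ⟨by simp, trivial⟩
      | node l h' L a r =>
        obtain ⟨h1, -⟩ := ih _ _ _ h
        exact ⟨by simp, (StateTree.forall_of_toList (p := fun L a => Wins m L a) _ _ h1).1⟩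
    · have key : ∀ t' s', check m n q t' s' = true → (t'.Forall (fun L a => Wins m L a) →
          t.Forall (fun L a => Wins m L a) ∧ Wins m L a) →
          (∀ u ∈ (L, a) :: q, Wins m u.1 u.2) ∧ t.Forall fun L a => Wins m L a := by
        intro t' s' hc hw
        obtain ⟨h1, h2⟩ := ih _ _ _ hc
        exact ⟨List.forall_mem_cons.2 ⟨(hw h2).2, h1⟩, (hw h2).1⟩
      simp only [check, force_eq] at h
      cases h0 : Nat.beq (Nat.mod s 32) 0 with
      | true =>
        simp only [h0, cond_true, Bool.cond_false_right, Bool.and_eq_true] at h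
        exact key _ _ h.2.2 fun ht => ⟨ht, wins_of_overfull (Nat.le_of_ble_eq_true h.1) h.2.1⟩
      | false =>
        cases h16 : Nat.ble (Nat.mod s 32) 16 with
        | false =>
          simp only [h0, h16, cond_false, Bool.cond_false_right, Bool.and_eq_true] at h
          refine key _ _ h.2 fun ht => ⟨ht, wins_of_overfull ?_ h.1⟩
          have : ¬ Nat.mod s 32 ≤ 16 := fun h => by simp [Nat.ble_eq_true_of_le h] at h16
          exact Nat.sub_pos_of_lt (not_le.1 this)
        | true =>
          simp only [h0, h16, cond_true, cond_false, Bool.cond_false_right, Bool.and_eq_true] at h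
          obtain ⟨hL, h⟩ := h
          have hd : 0 < Nat.mod s 32 :=
            Nat.pos_of_ne_zero fun h => by rw [h] at h0; cases h0
          generalize Nat.mod s 32 = d at *
          obtain ⟨c, hc⟩ := forceList_eq (insertDesc d [d] a) 0
          rw [hc] at h
          obtain ⟨t', ht, ht'⟩ :=
            exists_branch d (insertDesc d [d] a) (Nat.mul c 0x100000000) L [] t
          rw [ht] at h
          refine key _ _ h fun hw => ?_
          obtain ⟨h1, h2⟩ := ht' (Wins m) hw
          refine ⟨h1, ?_⟩
          rw [coe_insertDesc, Multiset.coe_singleton, Multiset.singleton_add,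
            Multiset.coe_nil, zero_add] at h2
          -- Branches that reach load 15 at once are not stored and carry no packing. `canTake`
          -- guarantees a stored branch, and its packing covers them.
          have hp : Packable m (d ::ₘ (a : Multiset ℕ)) := by
            cases L with
            | nil => cases hL
            | cons x L =>
              exact (h2 x List.mem_cons_self (Nat.lt_succ_of_le (Nat.le_of_ble_eq_true hL))).packable
                Multiset.cons_ne_zero
          refine .send d hd fun x hx => ?_
          by_cases hxd : x + d < 15
          · exact h2 x hx hxd
          · exact .full (Multiset.mem_cons_self _ _) (not_lt.1 hxd) hp

/-! ### From the integer game to real instances and algorithms -/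

/-- The sequence of items whose sizes are those in `l`, measured in elevenths. -/
noncomputable def scaled (l : List ℕ) : List ℝ :=
  l.map fun x : ℕ => (x : ℝ) / 11

def natLoad (l : List ℕ) (S : Finset ℕ) : ℕ :=
  ∑ j ∈ S, l.getD j 0

theorem load_scaled (l : List ℕ) (S : Finset ℕ) : load (scaled l) S = natLoad l S / 11 := by
  have h : ∀ j, (scaled l).getD j 0 = (l.getD j 0 : ℕ) / (11 : ℝ) := fun j => by
    rcases lt_or_ge j l.length with hj | hj
    · rw [List.getD_eq_getElem _ _ hj, List.getD_eq_getElem _ _ (by simpa [scaled] using hj)]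
      simp [scaled]
    · rw [List.getD_eq_default _ _ hj, List.getD_eq_default _ _ (by simpa [scaled] using hj)]
      simp
  simp only [load, natLoad, h, Nat.cast_sum, Finset.sum_div]

/-- Splits the positions according to a splitting of the multiset of sizes: the last item lies in
some part, goes to that bin, and is removed from the part. `i₀` is only the default bin for
positions beyond the list. -/
theorem exists_assignment {m : ℕ} (i₀ : Fin m) (l : List ℕ) :
    ∀ f : Fin m → Multiset ℕ, ∑ i, f i = l → ∃ c : ℕ → Fin m, ∀ i,
      natLoad l ((Finset.range l.length).filter fun j => c j = i) = (f i).sum := by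
  induction l using List.reverseRecOn with
  | nil =>
    intro f hf
    refine ⟨fun _ => i₀, fun i => ?_⟩
    have : f i ≤ ∑ i, f i := Finset.single_le_sum (fun _ _ => Multiset.zero_le _) (Finset.mem_univ i)
    rw [hf, Multiset.coe_nil, Multiset.le_zero] at this
    simp [natLoad, this]
  | append_singleton l x ih =>
    intro f hf
    obtain ⟨i, -, hi⟩ : ∃ i ∈ Finset.univ, x ∈ f i := by
      rw [← Multiset.mem_sum, hf]
      simp
    obtain ⟨b, hb⟩ := Multiset.exists_cons_of_mem hi
    obtain ⟨c, hc⟩ := ih (Function.update f i b) (by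
      rw [← Multiset.coe_add, Multiset.coe_singleton, add_comm, Multiset.singleton_add,
        ← Finset.add_sum_erase _ _ (Finset.mem_univ i), hb, Multiset.cons_add,
        Multiset.cons_inj_right] at hf
      rw [← Finset.add_sum_erase _ _ (Finset.mem_univ i), Function.update_self, ← hf]
      congr 1
      exact Finset.sum_congr rfl fun j hj => Function.update_of_ne (Finset.ne_of_mem_erase hj) _ _)
    refine ⟨Function.update c l.length i, fun i' => ?_⟩
    have h1 := hc i'
    simp only [natLoad, Finset.sum_filter] at h1 ⊢
    rw [List.length_append, List.length_singleton, Finset.sum_range_succ, Function.update_self]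
    have h2 : ∀ j ∈ Finset.range l.length,
        (if Function.update c l.length i j = i' then (l ++ [x]).getD j 0 else 0) =
          if c j = i' then l.getD j 0 else 0 := fun j hj => by
      have hj := Finset.mem_range.1 hj
      rw [Function.update_of_ne hj.ne, List.getD_append _ _ _ _ hj]
    rw [Finset.sum_congr rfl h2, h1]
    by_cases h : i = i'
    · subst h
      simp [hb, add_comm]
    · simp [h, Function.update_of_ne (Ne.symm h)]

theorem isInstance_scaled {m : ℕ} (i₀ : Fin m) {l : List ℕ} (hl : ∀ x ∈ l, 0 < x)
    (hp : Packable m l) : IsInstance m (scaled l) := by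
  refine ⟨fun x hx => ?_, ?_⟩
  · obtain ⟨n, hn, rfl⟩ := List.mem_map.1 hx
    have : (0 : ℝ) < n := Nat.cast_pos.2 (hl n hn)
    positivity
  · obtain ⟨f, hf, hc⟩ := hp
    obtain ⟨c, h⟩ := exists_assignment i₀ l f hf
    refine ⟨fun i => (Finset.range l.length).filter fun j => c j = i, ⟨fun i i' hii => ?_, ?_⟩,
      fun i => ?_⟩
    · rw [Finset.disjoint_left]
      intro j hj hj'
      exact hii ((Finset.mem_filter.1 hj).2.symm.trans (Finset.mem_filter.1 hj').2)
    · ext j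
      simp [scaled]
    · rw [load_scaled, h, div_le_one (by norm_num)]
      exact_mod_cast hc i

theorem packing_append {m : ℕ} (A : Algorithm m) (I J : List ℝ) (j : ℕ) (hj : j ≤ I.length) :
    packing A (I ++ J) j = packing A I j := by
  induction j with
  | zero => rfl
  | succ j ih =>
    funext i
    simp only [packing, ih (Nat.le_of_succ_le hj)]
    rw [List.take_append_of_le_length (Nat.le_of_succ_le hj), List.getD_append _ _ _ _ hj]

theorem natLoad_append {l l' : List ℕ} {S : Finset ℕ} (hS : S ⊆ Finset.range l.length) :
    natLoad (l ++ l') S = natLoad l S :=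
  Finset.sum_congr rfl fun _ hj => List.getD_append _ _ _ _ (Finset.mem_range.1 (hS hj))

theorem map_update_univ {m : ℕ} (g : Fin m → ℕ) (i : Fin m) (y : ℕ) :
    (Finset.univ.val.map fun j => if i = j then g j + y else g j) =
      (g i + y) ::ₘ (Finset.univ.val.map g).erase (g i) := by
  obtain ⟨s, hs⟩ := Multiset.exists_cons_of_mem (Finset.mem_univ_val i)
  have hi : i ∉ s := by
    have := (Finset.univ : Finset (Fin m)).nodup
    rw [hs] at this
    exact (Multiset.nodup_cons.1 this).1
  rw [hs, Multiset.map_cons, Multiset.map_cons, Multiset.erase_cons_head, if_pos rfl]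
  congr 1
  exact Multiset.map_congr rfl fun j hj => if_neg (ne_of_mem_of_not_mem hj hi).symm

/-- The algorithm may use the history and the names of the bins, but `Wins` covers placement on
every load present, so each answer of `A` selects a branch. The invariant is that the loads produced
by `A` form the multiset `L`. -/
theorem exists_of_wins {m : ℕ} (A : Algorithm m) {L a : Multiset ℕ} (h : Wins m L a) :
    ∀ l : List ℕ, (∀ x ∈ l, 0 < x) → (l : Multiset ℕ) = a →
      (Finset.univ.val.map fun i => natLoad l (packing A (scaled l) l.length i)) = L →
      ∃ l' : List ℕ, (∀ x ∈ l', 0 < x) ∧ Packable m l' ∧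
        ∃ i, 15 ≤ natLoad l' (packing A (scaled l') l'.length i) := by
  induction h with
  | full hx h15 hp =>
    rintro l hl rfl rfl
    obtain ⟨i, -, rfl⟩ := Multiset.mem_map.1 hx
    exact ⟨l, hl, hp, i, h15⟩
  | send y hy _ ih =>
    rintro l hl rfl rfl
    have hlen : (scaled l).length = l.length := by simp [scaled]
    have happ : scaled (l ++ [y]) = scaled l ++ scaled [y] := by simp [scaled]
    set P := packing A (scaled l) l.length with hP
    have hPs : ∀ i, P i ⊆ Finset.range l.length := fun i => by
      rw [← (isPartition_packing A (scaled l) l.length).2]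
      exact Finset.subset_biUnion_of_mem P (Finset.mem_univ i)
    set i₀ := A ((scaled (l ++ [y])).take l.length) ((scaled (l ++ [y])).getD l.length 0) P with hi₀
    refine ih _ (Multiset.mem_map_of_mem _ (Finset.mem_univ_val i₀)) (l ++ [y]) ?_ ?_ ?_
    · intro x hx
      rcases List.mem_append.1 hx with hx | hx
      · exact hl x hx
      · rwa [List.mem_singleton.1 hx]
    · rw [← Multiset.coe_add, Multiset.coe_singleton, add_comm, Multiset.singleton_add]
    · rw [← map_update_univ fun i => natLoad l (P i)]
      refine Multiset.map_congr rfl fun i _ => ?_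
      have hPP : packing A (scaled (l ++ [y])) l.length = P := by
        rw [happ, packing_append A _ _ _ hlen.ge]
      rw [List.length_append, List.length_singleton, packing, hPP, ← hi₀]
      beta_reduce
      split_ifs with h
      · have hn : l.length ∉ P i := fun h => by simpa using hPs i h
        rw [natLoad, Finset.sum_insert hn, ← natLoad, natLoad_append (hPs i), add_comm]
        simp
      · exact natLoad_append (hPs i)

theorem exists_result_ge {m : ℕ} (i₀ : Fin m) (h : Wins m (Multiset.replicate m 0) 0)
    (A : Algorithm m) : ∃ I, IsInstance m I ∧ 15 / 11 ≤ result I A := by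
  obtain ⟨l, hl, hp, i, hi⟩ := exists_of_wins A h [] (by simp) rfl (by
    simp [natLoad, packing])
  refine ⟨scaled l, isInstance_scaled i₀ hl hp, ?_⟩
  refine le_trans ?_ (le_ciSup (Finite.bddAbove_range _) i)
  rw [load_scaled]
  have : (scaled l).length = l.length := by simp [scaled]
  rw [this]
  gcongr
  exact_mod_cast hi

theorem lower_bounds {m : ℕ} (h : ∀ A : Algorithm m, ∃ I, IsInstance m I ∧ 15 / 11 ≤ result I A)
    (i₀ : Fin m) :
    (∀ A : Algorithm m, ∃ I, IsInstance m I ∧ 15 / 11 ≤ result I A) ∧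
      (∀ A : Algorithm m, 15 / 11 ≤ stretchingFactor A) ∧
      15 / 11 ≤ optimalStretchingFactor m := by
  have h2 : ∀ A : Algorithm m, 15 / 11 ≤ stretchingFactor A := fun A => by
    obtain ⟨I, hI, hr⟩ := h A
    exact hr.trans (le_csSup (bddAbove_results A) ⟨I, hI, rfl⟩)
  -- A real infimum over an empty type would be 0, so some algorithm must exist.
  have : Nonempty (Algorithm m) := ⟨fun _ _ _ => i₀⟩
  exact ⟨h, h2, le_ciInf h2⟩

theorem bounds_of_check {m n s : ℕ} (i₀ : Fin m)
    (h : check m n [(List.replicate m 0, [])] .empty s = true) :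
    (∀ A : Algorithm m, ∃ I, IsInstance m I ∧ 15 / 11 ≤ result I A) ∧
      (∀ A : Algorithm m, 15 / 11 ≤ stretchingFactor A) ∧
      15 / 11 ≤ optimalStretchingFactor m := by
  refine lower_bounds (exists_result_ge i₀ ?_) i₀
  exact (wins_of_check _ _ _ _ _ h).1 _ List.mem_cons_self

/-! ### The strategies and their evaluation -/

/-- A strategy for `6` bins, in the encoding of `check`. -/
def strategy6 : ℕ :=
  0xd5adb2ded6be77bbe317be0a4b6f45bef57bdf66b8f63d5ef7d6363bdef7c62e6b8f18d62f9be2e1beef7d60a500004000000000050337be718bdc38cef18c635abe337ceb5ac6ee6d6f792e31ac62f7c6318de0b8c5ef9ce33bc6f37de3583635bb8ca6c6318d5f17c62fbb8f59decc7c5f38beafad6cf81ef633e71b2e857d1f37b8f07d0cb7beb44c1f7bc5f1a296e4bdee3d9f02ddc9926317be37bbeef7be0b8def04de8b7d1f25deb77d6717b8f17ce35b3ef18de379bef47d13182ef3ac1f58be317d1cf8c6f3bd88fbb8f1bde717c9378c9b193e357cec00008000000000140c6efbc6c43decb8de6f8000020000000000500e5262fbd90f9d9c772937826f1921098b8cc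3deef8ce30426f6426377b9b3bc12e415f17d1f79deee6dec64de377bec8421b241dc64cec9bde098b8c98d10822631bc649bde083d10e2be098c1f7a19f1b19378d9862c6324210bb1931b21307c6b07d9358d0b3b20b3a21467167791e359d90e3190c4d9087ce45b19c9b213241e4b8de727c0b7b1e70526c4626f3ace07b11087d9047d1362d9363d8c5939c451ec84dece720b622104310c4408821

/-- The number 5300 is fuel, consumed by each treated state and each change of layer; too small a
value could only make the check fail. -/
theorem check_strategy6 : check 6 5300 [(List.replicate 6 0, [])] .empty strategy6 = true := by
  decide +kernel

/-- A strategy for `7` bins, in the encoding of `check`. -/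
def strategy7 : ℕ :=
  0x317ce2f7be6c000000300c00000001c16d9b3bce345c635ac635adecf62db1ab6317c62d6deb19bdf00000c07000000000028162dad8c600000002000000000050300000c0700000000002816c6f18d6317b62f83970000000300000000001c16ddb18b1f56b8000300c000000000070630000000100000000002807b5b17000000180000000000e02db18beaf6c637bb5ad8d9af8ddb76cdcfad92fabeed62df77c637a000060000000000000e0bef7821c00018000000000000382e73eee7becb7b6ae00000010000000000281725b57b6f773eef7c68f8c5edadd8a0000c0000000000001c1abeafbb6b5b2eed835f76c9b7b39400018000000000000382fbcef65beb67b16f7bef5900000008000000000140de74536cb715b60000c0000000000001c1ab8b77dec9abe377d6cb6bdc00018000000000000380f72eef7de2f8bdf62ceef6ce318cef38b96e620000301c0000000000a01b7b00000018000000000140beef736c9829738c5f17deafbdec5b25b1bd6338cdee000080000000000002819be46000000700000000002805de0b8de6f7c60b8d96d7d94a2be376c5cb7ce37bd633bdef78c631829323b8000301c0000000000a01058de45bb5f38c64b8d9777b5f38c631ac6f17c931b262f7be0d9314b7be366cded92e705c6b76beca5de2f6de2f7ddb18d133bc5efb2df7829b372e31bbdf04c000020000000000000a0608000000700000000002817b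e737d96d92def7def78def1b263200008000000000000281b2170721f5ac5cc73ec58c6317deef7deaf7ceaf8c14b8c1f04cef78de0fa2e318ceb07c1363216d8de31826445c90d8de08339f45c0f18c60a4be318c6318d90e41dc77cdf18c6c0007000000000000050099def193ecfb2df4420b18c6304bdf7bbe2e4c1efacef0718c5b20000e0000000000000a064b92e318260b8beb18212fbb973abdf77bdf7b28b04c10872175a2e4a52e0f8c6ca6de77bc6ef8cecb7c60fbc5c99c0afbd905a25ce226f7bde098ce4bb260fad8b79de325c6b38def7826f6139cb8c6f7b26f79ddf03de37bc8c571dc87decb8d9ca7de378268b821327def19c8b5bde327ce71926c79c6ef82dee6c6ce3ce319de338d1307be717c8f79c17173ef57c67573eca3c62f9ddf783ef58be0d826f07d9f79ce078d1cfa26b1921099dec59392e6ddf7bde467c6f07de098be09ace8bac1f24de778cef17cdcf9193673e778c677bd90e2c609bbec7829c87c1b042e46521f273e7042000010000000000000a01047deb05b9078d9f06d800010000000000000a010671e03826f67d8f65c6ef8bef042e087dec43c6f18d1f7b1e0d926f7bdec473630626087decdbc8f633e0a4de0983eb2726c9b3e37b2907bc136421cfbde49b26f65c9479c6c99c64fb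de4a4210e421f67d9365def39d9499d6f62d9764d9047d889b3e0e2c9cbbd8879dec9ad909bc6b7b29722c94fbc8f27d8c78de09a1645b3ec82c8b64d9079c9099cef1ac1b3818c64d988629085cec85decc6c67791e484c9ce63937b1e7052ec4428f79d670320847d8c47d1364d9364d8c5939c4516c84dece720b622104310c4408821

theorem check_strategy7 : check 7 5300 [(List.replicate 7 0, [])] .empty strategy7 = true := by
  decide +kernel

/-- A strategy for `8` bins, in the encoding of `check`. -/
def strategy8 : ℕ :=
  0x338b6edb3975a2eafabdad6b5b39b5adbb1f17ce4b6c6367b5b37d96d6c14f7d973bdef05c5ed7c6096be2d6c6f77be00000006038000000000120ddad6b58c4cdf59be33ab5adbc9f4000040003c00000000007058000081e0780000000000e0bd8b6b8ed83e097beeda3dadbc66dbb0000103c0f00000000001c052ef39b66d92db57c9707cdb25000020001e000000000038356296d6b60b6de6d6bded9dead8bdb7bddf78c16db1db58b60dac12dbd0000301c0f00000000002816c5ae7deac3b5f1bbdedab5cfbd6ec5c175ac5ad8b5ad8b5b16be6fb000060381e0000000000502d6be6c5beac4c1ef7bdac2b5c00038000000000000000e0b6317c6377b9f65ddb18b9757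0000400800000000000050000008000000000000000e0c60b8d5c0000002000000000000120c000000040300000000002805214000100200000000000014000000008060000000000500591d8e5c66f7b58e5c000070000000000000001c04c62f6b1ef7b800000040300000000002817bdf1ad5f4000000100c0000000000a01717d1c86bef1ab5f59000003f000000000000050365be31ab6856d60a00000010000000000000901716bef782977a3ecb7d94fb194b9ce0e4def4000007e0000000000000a06b19c0c0000002000000000000120c6378ddefb296f6ddb44c6b3bdef77b96c6d5c00000fc0000000000001400000200000000000000038317c800070000000000000001c052800010000000000000001c182dee5b5ad8be6f6c90b6d6344d0000000400000000000024000004000000000000000706305bdf58c9707b6717ce318c5f19be0b9be317be306c62f8bec0007000000000000000140beb1b25f78deb7a2631bd6b37c1f3a000003f00000000000005031addf1bde77b0001c00000000000000050377b94b7be776de6f8c5eface73bc67192e0b6c5f18c6357c6078b1b19ce2d8be702de6d8c5b07c5f19ceb05c62f6c62e500002000000000000000382f9d6319b633bc8000200000000000000028180000200000000000000048359cdf7836317cdf05262f7beaf8c671bc6f18b8b7bb5ef7deef8c6736162f6be3652dec5c6497c5b79bef1bb5f1b16f1bd8b382e4b815b18cd800000fc000000000000140be0f72e0f8c62f8b9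338c60f9d5ef7d1ad8c6318be317c6337c62e7b677739b19c92f6197163e378be738162c7b9057c6378c9c4000007e0000000000000a06c4000040000000000000007018f8c177bc62f8de0d8cdcb8c0000301c0f00000000002817be37b18f67c6b77ce8000180e078000000000140bef1ac5f77cdf18d96f6c60b9bdcb7d92e2c6f06b6f18cec843e459d6716c6320000c0703c0000000000a05cdbd16fbdef65c6338c6c000180e0780000000001402ef39de40000800000000000000120c671ace00000800000000000000120c6317d677bc6f77bef3bb9ae7cdf3bbecface31bc6f78d5cf7beef73ec98c600000002000000000000140bef19c6f7bce0f8de2e5c68d7de0bbbe31931377cdf183e2f7b1f182e77bc62f8c6377c685829ee7de71bb9f7bbe2e7b8b7bbdef8c6efbc6f1b39707c60e5b8000e000000000000000281abecd7bef17cef3bcef3bce777de318de31ac6318c97180000201800000000000050378366f926ee5c6b6536cbb1e4a5ddf5bb6c9ac62fbc1b65c6efa3eaf7bef1ac6f04d80001000000000000000281bde362ceefb00002000000000000000502fad92f7d8f38ddf57ceaf70000200000000000000038058d6357cef58c5f57b6b57cef5bddee7000020180000000000005035bc62e5bec583ef1bcdf3bd800030000000000000001c18c62f8ce75bde08629738b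96f829717c5f1bbe000018000000000000000e0c16f8beb772e37bd5f06b9719bdf18c1af9c6458ce00000806000000000000140ce323c6778c63183e347d9f5abdf1700002018000000000000502fb26367c5f000004030000000000000a013393ef00000c000000000000000706737d5f78b9f78b9739d800020000000000000002818d92fb0000201800000000000050339c6b62d9325b9cf926319c64e3c6c00018000000000000000e0c5f78c6af8c6096c6b58ddcf7c6b7ac6f58beb5abe717bdc47ddc800004030000000000000a06f18b9777de2f7de378deefb26318b94fac6ed92171bc17662ef173e307deef7c6400008060000000000001403e0573e318362f8be8a7d64c7c0000000c0000000000002817d5afbd5cf73ecc00004000000000000000705ef9c6f7b00000008000000000000500453e2f7bdee416318c000030000000000000001c02c6f78c6f78cdf1bc635939f78c6ee6c6318d88e5be8a6c6efb0dcdbdef042e364d9718cef7bc9717cdf78c5f7bc6b392e0f8c5ce42e0dbd9af8bdefa3ef79de2e7beb1829318bdefb208f8bdf1b16cf8d8f79d62e4c6f64c6f3bddf17d1378d9757ddf7b00002000000000000000502f9def7716717c5f7bcdf7826f4329704c631bc6b78def0436359c6359c1364de338c60c5c1c98cef400004000000000000000a060db310f9b9318de765d131ace084d6057bef1b26f18c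8f06ce304cef633e347d94e73e71b29f7ac5efbc173bde00001000000000000000140b9f37de2f8ceb17d8ce4c1cd8c6ef835cf7c64f8c5cbbbe6fb3df17d5f37de2e72e306deb3b3e343beaf82ecbbddee5c6cb7c5f1bbe327c66d8def67c6b17c6325ce364d9f7bd9f793ef58c60e7b84fbde77b3e3793e087b86e7de89bd93783ef18c62e3c6c843eefbd1cfac0ca3d6f23d8000000c000000000000280426ae4beb18ce2e2cec98bef7ad5ca42ecb83e35abe0f7c16fa314e4c16fbbdf19c6719c6f03ce0b73e2e5c6b07c64fbde317c1f38beaf8be319ce48735f3bde2f726f26c1319ce487def58c6b193e3042dcb8c10f7be0e53145b396f9b9737d6357c671bc6f19c6f47c9f200008000000000000000a05f37bdf1bbef02c6738b9379ddf3bdef04bef1b2def7ddf18c6319c6078292fad6318d635839717bdf19c6717ceb78dec43c9f0739f66ce765d931b2ef78b9319d8f78cef1addf1826c57ddc98ddf0726347beaf9be77736b17be2f8b9099bdcb7be2fb35f18bdcbbc60f7be897c5f18def1925cd8ddefacecb8c1764be318ce499c5f65ce2f8c9718b9c78d6f17deef8d6718ddf79bdf1b39f1abdf38ddf77b909bce3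173e724c6b393e339c6f1826899c60e7c633b26f1b1ef26be365c6337c6f18c6705de7183eef8b9305d935bc5f78c60a3c6f76ceb39ce35bc5f6318c58c5f783ef1b39f38d9f7b287181eee5c6f58ce2f9d6737d64fbc9318c8b1ab8ef7c1ce7c6f63b8cb93e31726ef8d000030000000000000002807c9723c6778c631821f4426484c68ba3e718c1c87c1378208783eb59de0f8c10f838c80000c000000000000000a010e73e0b8bdf773971abdf78c5f7826347de3172eb072e37ad6343c1763d90fbde3770001c00000000000000050323d90a72171bce8e5c62e43e6fa2e098c9cb82e0f8ce087be75bc1f78c6497deb383eb38c1efac1ee4c6b47c94e4c5f0739ef821ce4c62f726cf9d1b1b3e37ad6f070001c000000000000000500fbc6705c60e5b933bd94e72e3652eae42930421307c64b80000600000000000000050318c1cb7c6b02b9c9bc6f37de323d6497d0f582e73b38f22d9778264b83dcfb3ecf8be317c90a5266f7260c7264b8de2e726f793e2f83ef78d0ee339307c62f7ceefbbeb19be317def67c671bc6778bef1adef18be48726f5b3e324bdf78ce7173e33b188fbdeaf8de0e7d9779c6064cef57ce738c8f77cef19c5f78ce327de739c9ee33e0a7de0b9be319be6fa3e4ba3e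379be2f8b9f1bc671b2ecfb26347c10b939cb8c137ac1337d1304c9b64c9318d9337d909ac90fa390a4b9c98d5f3bc60a720cfbc90e4c1f63d0cdbde73bc1f78b8882c631a38b253eee50001c000000000000000500ba3ef18bef79c5f77decf8c0ee4ce318c1b77ce317d6739d1339c63181e6f816479c6498312fa26b47ce344d60a721364be318390fb26f243e3383eb19d637bc133bdec85ce3052ef65d9f5a2600007000000000000000140d173bc6357c64e3be743c675ab97382e718c10e516cf9c6ef71e700000c000000000000000a0000010000000000000002804c1c98de37b10ce41ec9bc1f0339f19c6f7bdecbadeb3b2e4e7c1f1b3df3bcef59d8747cdf02d647ac63651105b1e847c131bc6b67de37bc63783e6f7bef183e4f8deafac17472637bc5f7a260f92e087c13262e0b92647bc6f18d6f633ef7bc6b1bd14bb38f18c6f1adef7a1df05c800030000000000000002804c9c9bce498c14771e738c14e6bef1b1e4f82ef04c1f64c9ce3de71836318ce0f8becbb2e0c7be0a4d6318d10e521307beb18c5f04c9ef8de367398bad0b7bcdf271ef27bef673eca53e72411f18c133bb931ac9739216f8c1f3adeef7c673bcef3bdeafbce40000800000000000000140c6ce5c60e5b9c000080000000000000014019378c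6318c13053631b26b1b3e098cef18c60e00004000000000000000a060e4c60dbde3073e0fbde777ceb59d9305390f915cf9ce8bbc1098be339263073e307deb25d9b39c6c9ad6f18c6f77de75ac1f382e71826b77ce319de87ac64f91ef782ec7b3e37ad9f17d90e225f67317042131826ee73ec84b9c5a1e05b2e8e321c583e4fb2e757c67422e0bbcef393e4f8deb78c607bcef1bc6718cec9a2ec9bde2f8ce379ce359d677bc6f3721cf7c6f18ce324c1f431ef00000c000000000000000a0131bc6765d1f19d60b9d94f8c1ce7de71716365114e5cecf916f27c64fad0b6516324b8f7bb9499d90e7d9f18394e73ef3b39319ceb27c64b929f273eb043ef7838b473e778c1c983eb783ec9bd0f5bc14bbc68bb39f7ad9042264f9c6f7920b6720f793907bd1f6729c4326f1b2e4e7d937bcecbac64bbc6760000c000000000000000a060bb3ef232e702be327d6f7b29c87de4991e483cef79c1f5bc6f053e0463ef58c9765cdee2c6863de327d9c7b3907816b7ad931b31b39bdf38cef04de364c9f6419cdac970338ce6210791133700006000000000000000500fb36727c6f37d0b7ad64a4ce3243e40001800000000000000140de35b2977bc107bcecf920cdbce499dece7ce4e7ceb24de0b53ece71e8a2c608239f6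4de71ad6f2529378decb9ce31ac9f19cec86de338de323c60a3def071ec85c6f67d6339d8ce5c137926ce2c937bc933839779c6f27c60fbce4f9c8c972ef07b9f1939f25d6765d9704d9f27cef24c8cfbd6b6728c7bdef3811f7a29ce739f5819044c1f032e44429ce4c633bde37b38f5911f26de4b800002000000000000000280fbdec78d90e7254fb21f65294f8de864ceb7b39b65c6b3b1ef6226b65c0f6736b7bde4a316f65d6f7818f02000060000000000000005036439c85c633bce8fbd9365c6ce6d977bc674726b78def60000c000000000000000a01339de77bc677a16727c9f3ad18a41607bdeca51e8fbdef7ac9c843ec5b2e8fb28f781906421085c9cf9c64e4be4f82eb5bc60a4d8cbbc6367d9cbb26c64290e71ef792649ad137bce37a39463c8cb9deb7b39f3bc9085260b9c687b2677a310fbc9b7bd6f6238f04de778cec4518f1bc1f3b3ec822eca4c9ce339ca516cbbd8b7bd932529cfbd8b19d1f26c60e2ce89b19b7bcef652e4992ef671e8e4d1c4711339c14a7c6f671ef6416b251ec58d0b22397472908416762d68e7393621e044ce4a2ce77a18f47ce047288c4d98bb308c3290f9d9f422ec5b1ec643e77ade744c9084c9ce22189bd8479114a5d88e321b791e46220847d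8c47d9364d937b164e310862d9024d9c472083b110621104408821

theorem check_strategy8 : check 8 5300 [(List.replicate 8 0, [])] .empty strategy8 = true := by
  decide +kernel

end BinStretching

theorem mainTheorem1 (m : ℕ) (hm : m = 6 ∨ m = 7 ∨ m = 8) :
    (∀ A : BinStretching.Algorithm m, ∃ I : List ℝ,
        BinStretching.IsInstance m I ∧ 15 / 11 ≤ BinStretching.result I A) ∧
      (∀ A : BinStretching.Algorithm m, 15 / 11 ≤ BinStretching.stretchingFactor A) ∧
      15 / 11 ≤ BinStretching.optimalStretchingFactor m := by
  rcases hm with rfl | rfl | rfl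
  · exact BinStretching.bounds_of_check 0 BinStretching.check_strategy6
  · exact BinStretching.bounds_of_check 0 BinStretching.check_strategy7
  · exact BinStretching.bounds_of_check 0 BinStretching.check_strategy8
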